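/- For all positive integers $n$ and non-negative integers $k$, $$\det_{0\le i,j\le n-1}\left(\sum_{l=-k}^{k+1}\binom{2i+2j}{i+j+l}\right)= \begin{cases} (-1)^{n_1\binom{k+1}{2}}, & \text{if } n=(k+1)n_1 \text{ for an integer } n_1\ge 0,\\ (-1)^{n_1\binom{k+1}{2}}, & \text{if } n=(k+1)n_1+1 \text{ for an integer } n_1\ge 0,\\ 0, & \text{if } n\not\equiv 0,1 \pmod{k+1}. \end{cases}$$ Here $\binom{N}{m}$ is the binomial coefficient for integers $N\ge 0$ and $m$, understood to be $0$ if $m<0$ or $m>N$. (For $k=0$ the first two cases overlap; both give the value $1$.) -/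

import Mathlib

/-- The binomial coefficient `n` over `m` with a natural upper and an integer lower parameter;
it is zero if `m < 0` (and, by `Nat.choose`, if `m > n`). -/
def binomInt (n : ℕ) (m : ℤ) : ℤ :=
  if 0 ≤ m then (n.choose m.toNat : ℤ) else 0

/-! The matrix is the Hankel matrix of the moments of L(f) = constant term of f(T + 2 + T⁻¹)·W,
where W is the sum of T ^ l over -k - 1 ≤ l ≤ k. Put K = k + 1. Since W(T - 1) = T^K - T^(-K),
Chebyshev polynomials in T^K + T^(-K) telescope against W, giving monic polynomials q_i of degree i
= K m + t for which q_i·W has only exponents of large absolute value, apart from a power of T + 2 +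
T⁻¹.

Pairing q_i with X ^ j is a unitriangular change of basis, so it keeps the determinant
(`det_windowPairing`). Row K m + t vanishes before column K m + (-t mod K), where the entry is 1 if
t = 0 and -1 otherwise. For n = K r this is a block permutation pattern whose sign and entries give
the value; for n = K r + 1 the last row is a unit vector; otherwise some row is zero. -/

/-! ### Signs of reversal and negation on `Fin n` -/

theorem Fin.sign_neg_succ (n : ℕ) :
    Equiv.Perm.sign (Equiv.neg (Fin (n + 1))) = Equiv.Perm.sign (Fin.revPerm : Equiv.Perm (Fin n)) := by
  -- Negation fixes 0 and reverses the nonzero residues.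
  have : Equiv.neg (Fin (n + 1)) = Equiv.Perm.decomposeFin.symm (0, Fin.revPerm) := by
    ext i
    refine Fin.cases ?_ (fun i => ?_) i
    · simp
    · have := i.2
      simp [Fin.val_neg, Fin.rev]
      omega
  rw [this, Equiv.Perm.decomposeFin.symm_sign]
  simp

theorem Fin.sign_revPerm (n : ℕ) :
    Equiv.Perm.sign (Fin.revPerm : Equiv.Perm (Fin n)) = (-1) ^ n.choose 2 := by
  induction n with
  | zero => rw [Subsingleton.elim (Fin.revPerm : Equiv.Perm (Fin 0)) 1]; simp
  | succ n ih =>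
    have : (Fin.revPerm : Equiv.Perm (Fin (n + 1))) =
        (finRotate (n + 1)).trans (Equiv.neg (Fin (n + 1))) := by
      ext i
      have h := i.2
      rw [Equiv.trans_apply, Equiv.neg_apply, Fin.val_neg', Fin.revPerm_apply, Fin.val_rev]
      rcases Fin.eq_castSucc_or_eq_last i with ⟨j, rfl⟩ | rfl
      · have := j.2
        rw [finRotate_apply, Fin.coeSucc_eq_succ, Fin.val_succ, Fin.val_castSucc,
          Nat.mod_eq_of_lt (by omega)]
      · simp
    rw [this, Equiv.Perm.sign_trans, Fin.sign_neg_succ, ih, sign_finRotate,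
      Nat.choose_succ_succ, pow_add]
    simp [mul_comm]

/-! ### Chebyshev polynomials: degrees and Laurent values -/

namespace Polynomial.Chebyshev

/-- A sequence satisfying the Vieta-Chebyshev recurrence is monic of the expected degrees as soon as
two consecutive terms are. -/
theorem monic_natDegree_of_recurrence {R : Type*} [CommRing R] [Nontrivial R] {P : ℕ → R[X]} {d : ℕ}
    (h0 : (P 0).Monic ∧ (P 0).natDegree = d) (h1 : (P 1).Monic ∧ (P 1).natDegree = d + 1)
    (h : ∀ n, P (n + 2) = X * P (n + 1) - P n) (n : ℕ) :
    (P n).Monic ∧ (P n).natDegree = n + d := by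
  induction n using Nat.twoStepInduction with
  | zero => simpa using h0
  | one => simpa [add_comm] using h1
  | more n ih0 ih1 =>
    have hm : (X * P (n + 1)).Monic := monic_X.mul ih1.1
    have hd : (X * P (n + 1)).natDegree = n + 2 + d := by
      rw [monic_X.natDegree_mul ih1.1, natDegree_X, ih1.2]; ring
    have hlt : (P n).natDegree < (X * P (n + 1)).natDegree := by rw [hd, ih0.2]; omega
    rw [h]
    exact ⟨hm.sub_of_left (degree_lt_degree hlt), by rw [natDegree_sub_eq_left_of_natDegree_lt hlt, hd]⟩

theorem monic_natDegree_S (n : ℕ) : (S ℤ n).Monic ∧ (S ℤ n).natDegree = n := by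
  refine monic_natDegree_of_recurrence (P := fun n : ℕ => S ℤ n) (d := 0) ?_ ?_ (fun n => ?_) n
  · simp
  · simp [monic_X]
  · simp [S_add_two]

/-- The index is shifted because C_0 = 2 is not monic. -/
theorem monic_natDegree_C (n : ℕ) :
    (C ℤ (n + 1 : ℕ)).Monic ∧ (C ℤ (n + 1 : ℕ)).natDegree = n + 1 := by
  refine monic_natDegree_of_recurrence (P := fun n : ℕ => C ℤ (n + 1 : ℕ)) (d := 1) ?_ ?_
    (fun n => ?_) n
  · simp [monic_X]
  · have : C ℤ ((1 + 1 : ℕ) : ℤ) = X ^ 2 - Polynomial.C 2 := by simp [C_two]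
    simp only [this]
    exact ⟨monic_X_pow_sub_C _ two_ne_zero, natDegree_X_pow_sub_C⟩
  · have := C_add_two ℤ (n + 1)
    push_cast
    rw [← this]; ring_nf

end Polynomial.Chebyshev

section
open LaurentPolynomial (T T_add)

theorem LaurentPolynomial.aeval_chebyshev_C (n : ℕ) :
    Polynomial.aeval (T 1 + T (-1) : LaurentPolynomial ℤ) (Polynomial.Chebyshev.C ℤ n) = T n + T (-n) := by
  induction n using Nat.twoStepInduction with
  | zero => simp [map_ofNat, one_add_one_eq_two]
  | one => simp
  | more n ih0 ih1 =>
    have e : ((n + 2 : ℕ) : ℤ) = (n : ℤ) + 2 := by push_cast; ring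
    push_cast at ih1
    rw [e, Polynomial.Chebyshev.C_add_two, map_sub, map_mul, ih0, ih1, Polynomial.aeval_X, add_mul, mul_add, mul_add]
    simp only [← T_add]
    ring_nf

theorem LaurentPolynomial.aeval_chebyshev_S (a : ℤ) (n : ℕ) :
    Polynomial.aeval (T a + T (-a) : LaurentPolynomial ℤ)
      (Polynomial.Chebyshev.S ℤ (n - 1)) * (T a - T (-a)) =
      T (n * a) - T (-(n * a)) := by
  induction n using Nat.twoStepInduction with
  | zero => simp
  | one => simp
  | more n ih0 ih1 =>
    have e : ((n + 2 : ℕ) : ℤ) - 1 = ((n : ℤ) - 1) + 2 := by push_cast; ring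
    have e' : ((n + 1 : ℕ) : ℤ) - 1 = ((n : ℤ) - 1) + 1 := by push_cast; ring
    rw [e'] at ih1
    rw [e, Polynomial.Chebyshev.S_add_two, map_sub, map_mul, sub_mul, mul_assoc, ih0, ih1, Polynomial.aeval_X, add_mul, mul_sub,
      mul_sub]
    simp only [← T_add]
    push_cast
    ring_nf

end

/-! ### Constant-term functional and quasi-orthogonal polynomials -/

section
open LaurentPolynomial

/-- `T + 2 + T⁻¹`, whose powers carry the central binomial rows as coefficients. -/
noncomputable def centralLaurent : LaurentPolynomial ℤ := T 1 + 2 + T (-1)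

theorem centralLaurent_pow (m : ℕ) :
    centralLaurent ^ m = ∑ i ∈ Finset.range (2 * m + 1), ((2 * m).choose i : ℤ) • T ((i : ℤ) - m) := by
  have h : centralLaurent = T (-1) * (T 1 + 1) ^ 2 := by
    have h1 : (T (-1) * T 1 : LaurentPolynomial ℤ) = 1 := by rw [← T_add]; simp
    unfold centralLaurent
    linear_combination (-(T 1) - 2) * h1
  rw [h, mul_pow, ← pow_mul, add_pow, Finset.mul_sum]
  refine Finset.sum_congr rfl fun i _ => ?_
  rw [one_pow, mul_one, T_pow, T_pow, ← mul_assoc, ← T_add, zsmul_eq_mul, mul_comm]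
  simp [sub_eq_neg_add]

theorem coeff_centralLaurent_pow_mul_T (m : ℕ) (b : ℤ) :
    (centralLaurent ^ m * T b).coeff 0 = binomInt (2 * m) (m - b) := by
  rw [centralLaurent_pow, Finset.sum_mul]
  simp only [smul_mul_assoc, ← T_add, AddMonoidAlgebra.coeff_sum, AddMonoidAlgebra.coeff_smul,
    Finsupp.finsetSum_apply, Finsupp.smul_apply, T_apply, smul_eq_mul, mul_ite, mul_one, mul_zero]
  unfold binomInt
  split_ifs with h
  · obtain ⟨c, hc⟩ := Int.eq_ofNat_of_zero_le h
    have e : ∀ i : ℕ, ((i : ℤ) - m + b = 0) ↔ c = i := by intro i; omega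
    simp only [e, Finset.sum_ite_eq, Finset.mem_range]
    split_ifs with h2
    · simp [hc]
    · rw [hc, Int.toNat_natCast, Nat.choose_eq_zero_of_lt (by omega)]; rfl
  · exact Finset.sum_eq_zero fun i _ => if_neg (by omega)

/-- The m-th power is supported on exponents -m to m, with both end coefficients 1; all
orthogonality below rests on this. -/
theorem coeff_centralLaurent_pow_mul_T_of_lt {m : ℕ} {b : ℤ} (h : (m : ℤ) < |b|) :
    (centralLaurent ^ m * T b).coeff 0 = 0 := by
  rw [coeff_centralLaurent_pow_mul_T, binomInt]
  split_ifs with h0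
  · rw [Nat.choose_eq_zero_of_lt]; · rfl
    rcases abs_cases b with h1 | h1 <;> omega
  · rfl

theorem coeff_centralLaurent_pow_mul_T_of_eq {m : ℕ} {b : ℤ} (h : |b| = m) :
    (centralLaurent ^ m * T b).coeff 0 = 1 := by
  rw [coeff_centralLaurent_pow_mul_T, binomInt]
  rcases abs_cases b with h1 | h1
  · rw [if_pos (by omega), show ((m : ℤ) - b).toNat = 0 by omega]; simp
  · rw [if_pos (by omega), show ((m : ℤ) - b).toNat = 2 * m by omega]; simp

theorem sum_Icc_neg_eq_sum_range {M : Type*} [AddCommMonoid M] (k : ℕ) (g : ℤ → M) :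
    ∑ l ∈ Finset.Icc (-(k : ℤ)) (k + 1), g (-l) =
      ∑ i ∈ Finset.range (2 * (k + 1)), g (-(k + 1 : ℕ) + i) := by
  refine Finset.sum_nbij' (fun l => (k + 1 - l).toNat) (fun i => (k : ℤ) + 1 - i) ?_ ?_ ?_ ?_ ?_
  · intro l hl; simp only [Finset.mem_Icc, Finset.mem_range] at *; omega
  · intro l hl; simp only [Finset.mem_Icc, Finset.mem_range] at *; omega
  · intro l hl; simp only [Finset.mem_Icc] at *; omega
  · intro l hl; simp only [Finset.mem_range] at *; omega
  · intro l hl; simp only [Finset.mem_Icc] at *; congr 1; omega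

theorem geom_sum_T (a : ℤ) (n : ℕ) :
    (∑ i ∈ Finset.range n, T (a + i)) * (T 1 - 1) = (T (a + n) - T a : LaurentPolynomial ℤ) := by
  have := Finset.sum_range_sub (fun i : ℕ => (T (a + i) : LaurentPolynomial ℤ)) n
  rw [Nat.cast_zero, add_zero] at this
  rw [← this, Finset.sum_mul]
  refine Finset.sum_congr rfl fun i _ => ?_
  rw [mul_sub, ← T_add, mul_one]; push_cast; ring_nf

/-- The Laurent polynomial `∑ T ^ l` over `-k - 1 ≤ l ≤ k`. -/
noncomputable def windowLaurent (k : ℕ) : LaurentPolynomial ℤ :=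
  ∑ l ∈ Finset.Icc (-(k : ℤ)) (k + 1), T (-l)

theorem windowLaurent_mul (k : ℕ) :
    windowLaurent k * (T 1 - 1) = T (k + 1 : ℕ) - T (-(k + 1 : ℕ)) := by
  rw [windowLaurent, sum_Icc_neg_eq_sum_range k (fun l => (T l : LaurentPolynomial ℤ)), geom_sum_T]
  push_cast; ring_nf

/-- The functional whose moments are the windowed central binomial sums. -/
noncomputable def windowFunctional (k : ℕ) (f : Polynomial ℤ) : ℤ :=
  (Polynomial.aeval centralLaurent f * windowLaurent k).coeff 0

theorem windowFunctional_X_pow (k m : ℕ) :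
    windowFunctional k (Polynomial.X ^ m) =
      ∑ l ∈ Finset.Icc (-(k : ℤ)) (k + 1), binomInt (2 * m) (m + l) := by
  rw [windowFunctional, map_pow, Polynomial.aeval_X, windowLaurent, Finset.mul_sum,
    AddMonoidAlgebra.coeff_sum, Finsupp.finsetSum_apply]
  simp [coeff_centralLaurent_pow_mul_T]

theorem windowFunctional_mul_X_pow (k j : ℕ) (f : Polynomial ℤ) {n : ℕ} (hn : f.natDegree < n) :
    windowFunctional k (f * Polynomial.X ^ j) =
      ∑ a ∈ Finset.range n, f.coeff a * windowFunctional k (Polynomial.X ^ (a + j)) := by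
  conv_lhs => rw [f.as_sum_range' n hn]
  simp only [windowFunctional, Finset.sum_mul, map_sum, AddMonoidAlgebra.coeff_sum,
    Finsupp.finsetSum_apply]
  refine Finset.sum_congr rfl fun a _ => ?_
  rw [← Polynomial.C_mul_X_pow_eq_monomial, mul_assoc, ← pow_add, map_mul, Polynomial.aeval_C,
    mul_assoc, ← Algebra.smul_def, AddMonoidAlgebra.coeff_smul, Finsupp.smul_apply, smul_eq_mul]

/-- The Chebyshev polynomial with `S_{m-1}(T^K + T^{-K})` as its value at `T + 2 + T⁻¹`. -/
noncomputable def dilatedS (K : ℕ) (m : ℤ) : Polynomial ℤ :=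
  (Polynomial.Chebyshev.S ℤ (m - 1)).comp
    ((Polynomial.Chebyshev.C ℤ K).comp (Polynomial.X - Polynomial.C 2))

theorem aeval_dilatedS_mul (K m : ℕ) :
    Polynomial.aeval centralLaurent (dilatedS K m) * (T K - T (-K)) =
      T (m * K) - T (-(m * K)) := by
  have : Polynomial.aeval centralLaurent (Polynomial.X - Polynomial.C 2 : Polynomial ℤ) =
      T 1 + T (-1) := by
    rw [map_sub, Polynomial.aeval_X, Polynomial.aeval_C, map_ofNat, centralLaurent]; ring
  rw [dilatedS, Polynomial.aeval_comp, Polynomial.aeval_comp, this,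
    LaurentPolynomial.aeval_chebyshev_C, LaurentPolynomial.aeval_chebyshev_S]

theorem monic_natDegree_dilatedS (k m : ℕ) :
    (dilatedS (k + 1) (m + 1)).Monic ∧ (dilatedS (k + 1) (m + 1)).natDegree = (k + 1) * m := by
  have hS := Polynomial.Chebyshev.monic_natDegree_S m
  have hC := Polynomial.Chebyshev.monic_natDegree_C k
  have h1 : ((Polynomial.Chebyshev.C ℤ (k + 1 : ℕ)).comp
      (Polynomial.X - Polynomial.C 2)).natDegree = k + 1 := by
    rw [Polynomial.natDegree_comp, hC.2, Polynomial.natDegree_X_sub_C, mul_one]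
  rw [dilatedS, add_sub_cancel_right]
  refine ⟨hS.1.comp (hC.1.comp (Polynomial.monic_X_sub_C 2)
    (by rw [Polynomial.natDegree_X_sub_C]; exact one_ne_zero)) (by omega), ?_⟩
  rw [Polynomial.natDegree_comp, h1, hS.2, mul_comm]

/-- A monic polynomial of degree `(k + 1) * m + t`, quasi-orthogonal for `windowFunctional k`. -/
noncomputable def quasiOrthogonal (k m t : ℕ) : Polynomial ℤ :=
  -- Two ways to absorb the denominator T - 1 of W: the difference leaves two geometric sums, while
  -- X - 4 becomes (T - 1)(1 - T⁻¹) and cancels it.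
  if t = 0 then dilatedS (k + 1) (m + 1) - dilatedS (k + 1) m
  else dilatedS (k + 1) (m + 1) * ((Polynomial.X - Polynomial.C 4) * Polynomial.X ^ (t - 1))

theorem monic_natDegree_quasiOrthogonal (k m t : ℕ) :
    (quasiOrthogonal k m t).Monic ∧ (quasiOrthogonal k m t).natDegree = (k + 1) * m + t := by
  obtain ⟨hM, hD⟩ := monic_natDegree_dilatedS k m
  unfold quasiOrthogonal
  split_ifs with ht
  · subst ht
    cases m with
    | zero =>
      -- S_{-1} = 0; a strict comparison of `natDegree` would fail here.
      have : dilatedS (k + 1) (0 : ℕ) = 0 := by simp [dilatedS]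
      rw [this, sub_zero]
      exact ⟨hM, hD⟩
    | succ m =>
      have hlt : (dilatedS (k + 1) (m + 1 : ℕ)).natDegree <
          (dilatedS (k + 1) ((m + 1 : ℕ) + 1)).natDegree := by
        rw [hD]; push_cast; rw [(monic_natDegree_dilatedS k m).2]; nlinarith
      exact ⟨hM.sub_of_left (Polynomial.degree_lt_degree hlt),
        by rw [Polynomial.natDegree_sub_eq_left_of_natDegree_lt hlt, hD, add_zero]⟩
  · have h4 := Polynomial.monic_X_sub_C (4 : ℤ)
    have hX := Polynomial.monic_X_pow (R := ℤ) (t - 1)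
    refine ⟨hM.mul (h4.mul hX), ?_⟩
    rw [hM.natDegree_mul (h4.mul hX), h4.natDegree_mul hX, hD, Polynomial.natDegree_X_sub_C,
      Polynomial.natDegree_X_pow]
    omega

theorem aeval_quasiOrthogonal_zero_mul (k m : ℕ) :
    Polynomial.aeval centralLaurent (quasiOrthogonal k m 0) * windowLaurent k =
      ∑ i ∈ Finset.range (k + 1), T ((m : ℤ) * (k + 1 : ℕ) + i) +
        ∑ i ∈ Finset.range (k + 1), T (-((m + 1 : ℕ) * (k + 1 : ℕ) : ℤ) + i) := by
  have hne : (T 1 - 1 : LaurentPolynomial ℤ) ≠ 0 := by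
    intro h
    have := congrArg (fun f : LaurentPolynomial ℤ => f.coeff 1) h
    simp [← T_zero] at this
  refine mul_right_cancel₀ hne ?_
  have h1 := aeval_dilatedS_mul (k + 1) (m + 1)
  have h0 := aeval_dilatedS_mul (k + 1) m
  rw [mul_assoc, windowLaurent_mul, add_mul, geom_sum_T, geom_sum_T, quasiOrthogonal, if_pos rfl,
    map_sub, sub_mul, h0]
  rw [Nat.cast_succ] at h1
  rw [h1]
  push_cast
  ring_nf

theorem aeval_quasiOrthogonal_mul {k m t N : ℕ} (ht : t ≠ 0) (hN : N + 1 = (m + 1) * (k + 1)) :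
    Polynomial.aeval centralLaurent (quasiOrthogonal k m t) * windowLaurent k =
      centralLaurent ^ (t - 1) * T (N + 1) - centralLaurent ^ (t - 1) * T N
        - centralLaurent ^ (t - 1) * T (-(N + 1)) + centralLaurent ^ (t - 1) * T (-(N + 2)) := by
  have h1 := aeval_dilatedS_mul (k + 1) (m + 1)
  have e : ((m + 1 : ℕ) : ℤ) * (k + 1 : ℕ) = N + 1 := by exact_mod_cast hN.symm
  rw [e, ← windowLaurent_mul, Nat.cast_succ] at h1
  have hT : (T (-1) * T 1 : LaurentPolynomial ℤ) = 1 := by rw [← T_add]; simp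
  have h4 : Polynomial.aeval centralLaurent (Polynomial.X - Polynomial.C 4 : Polynomial ℤ) =
      (T 1 - 1) * (1 - T (-1)) := by
    simp [centralLaurent, map_ofNat]; linear_combination hT
  have e2 : (T (N + 1) * T (-1) : LaurentPolynomial ℤ) = T N := by rw [← T_add]; ring_nf
  have e3 : (T (-(N + 1)) * T (-1) : LaurentPolynomial ℤ) = T (-(N + 2)) := by
    rw [← T_add]; ring_nf
  rw [quasiOrthogonal, if_neg ht, map_mul, map_mul, h4, map_pow, Polynomial.aeval_X, ← e2, ← e3]
  linear_combination (1 - T (-1)) * centralLaurent ^ (t - 1) * h1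

/-- Among the exponents of the two geometric sums, only (k + 1) m has absolute value at most (k + 1)
m. -/
theorem windowFunctional_quasiOrthogonal_zero {k m j : ℕ} (hj : j ≤ (k + 1) * m) :
    windowFunctional k (quasiOrthogonal k m 0 * Polynomial.X ^ j) =
      if j = (k + 1) * m then 1 else 0 := by
  have hj' : (j : ℤ) ≤ m * (k + 1 : ℕ) := by rw [mul_comm]; exact_mod_cast hj
  have hm : ((m + 1 : ℕ) : ℤ) * (k + 1 : ℕ) = m * (k + 1 : ℕ) + (k + 1) := by push_cast; ring
  have hiff : j = (k + 1) * m ↔ (j : ℤ) = m * (k + 1 : ℕ) := by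
    rw [mul_comm]; exact_mod_cast Iff.rfl
  rw [windowFunctional, map_mul, map_pow, Polynomial.aeval_X, mul_comm, ← mul_assoc,
    mul_comm (windowLaurent k), aeval_quasiOrthogonal_zero_mul, mul_comm, hm, mul_add,
    Finset.mul_sum, Finset.mul_sum, Finset.sum_range_succ', if_congr hiff rfl rfl]
  generalize (m : ℤ) * (k + 1 : ℕ) = A at *
  simp only [AddMonoidAlgebra.coeff_add, AddMonoidAlgebra.coeff_sum, Finsupp.add_apply,
    Finsupp.finsetSum_apply]
  rw [Finset.sum_eq_zero, Finset.sum_eq_zero, zero_add, add_zero, Nat.cast_zero, add_zero]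
  · split_ifs with h
    · exact coeff_centralLaurent_pow_mul_T_of_eq (by rw [abs_of_nonneg] <;> omega)
    · exact coeff_centralLaurent_pow_mul_T_of_lt (by rw [abs_of_nonneg] <;> omega)
  · intro i hi
    rw [Finset.mem_range] at hi
    exact coeff_centralLaurent_pow_mul_T_of_lt (by rw [abs_of_neg] <;> omega)
  · intro i hi
    exact coeff_centralLaurent_pow_mul_T_of_lt (by rw [abs_of_nonneg] <;> omega)

/-- Of the four shifts N + 1, N, -(N + 1), -(N + 2), only N can be reached by the power t - 1 + j ≤
N, and it carries the sign -1. -/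
theorem windowFunctional_quasiOrthogonal {k m t j : ℕ} (ht : t ≠ 0)
    (hj : j + t ≤ (k + 1) * (m + 1)) :
    windowFunctional k (quasiOrthogonal k m t * Polynomial.X ^ j) =
      if j + t = (k + 1) * (m + 1) then -1 else 0 := by
  obtain ⟨N, hN⟩ : ∃ N, N + 1 = (k + 1) * (m + 1) := ⟨_, Nat.succ_pred_eq_of_pos (by positivity)⟩
  have hmul (b : ℤ) : centralLaurent ^ (t - 1) * T b * centralLaurent ^ j =
      centralLaurent ^ (t - 1 + j) * T b := by rw [pow_add]; ring
  rw [windowFunctional, map_mul, map_pow, Polynomial.aeval_X, mul_right_comm,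
    aeval_quasiOrthogonal_mul ht (by rw [hN, mul_comm]), add_mul, sub_mul, sub_mul, hmul, hmul, hmul,
    hmul, ← hN]
  simp only [AddMonoidAlgebra.coeff_add, AddMonoidAlgebra.coeff_sub, Finsupp.add_apply,
    Finsupp.sub_apply]
  rw [coeff_centralLaurent_pow_mul_T_of_lt (b := N + 1) (by rw [abs_of_nonneg] <;> omega),
    coeff_centralLaurent_pow_mul_T_of_lt (b := -(N + 1)) (by rw [abs_of_neg] <;> omega),
    coeff_centralLaurent_pow_mul_T_of_lt (b := -(N + 2)) (by rw [abs_of_neg] <;> omega)]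
  split_ifs with h
  · rw [coeff_centralLaurent_pow_mul_T_of_eq (by rw [abs_of_nonneg] <;> omega)]; norm_num
  · rw [coeff_centralLaurent_pow_mul_T_of_lt (by rw [abs_of_nonneg] <;> omega)]; norm_num
end

/-! ### Evaluation of the Hankel determinant -/

/-- A matrix vanishing to the left of the graph of a permutation has a one-term determinant. -/
theorem Matrix.det_of_eq_zero_of_lt_perm {R m : Type*} [CommRing R] [Fintype m] [LinearOrder m]
    (M : Matrix m m R) (e : Equiv.Perm m) (h : ∀ i j, j < e i → M i j = 0) :
    M.det = Equiv.Perm.sign e * ∏ i, M i (e i) := by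
  have hT : (M.submatrix e.symm id).IsUpperTriangular := fun i j hij => h _ _ (by simpa using hij)
  have hd := Matrix.det_of_isUpperTriangular hT
  rw [Matrix.det_permute, Equiv.Perm.sign_symm] at hd
  rw [← Equiv.prod_comp e] at hd
  simp only [Matrix.submatrix_apply, Equiv.symm_apply_apply, id] at hd
  rw [← hd, ← mul_assoc, ← Int.cast_mul, ← Units.val_mul, Int.units_mul_self]
  simp

/-- The Hankel matrix of the moments of `windowFunctional k`. -/
noncomputable def windowHankel (k n : ℕ) : Matrix (Fin n) (Fin n) ℤ :=
  Matrix.of fun i j => windowFunctional k (Polynomial.X ^ ((i : ℕ) + j))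

theorem windowHankel_eq (k n : ℕ) :
    windowHankel k n = Matrix.of fun i j : Fin n =>
      ∑ l ∈ Finset.Icc (-(k : ℤ)) ((k : ℤ) + 1),
        binomInt (2 * (i : ℕ) + 2 * (j : ℕ)) (((i : ℕ) : ℤ) + ((j : ℕ) : ℤ) + l) := by
  ext i j
  simp only [windowHankel, Matrix.of_apply, windowFunctional_X_pow, Nat.mul_add, Nat.cast_add]

/-- `quasiOrthogonal`, indexed by the degree. -/
noncomputable def quasiOrthogonalOfDegree (k i : ℕ) : Polynomial ℤ :=
  quasiOrthogonal k (i / (k + 1)) (i % (k + 1))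

/-- The matrix pairing the quasi-orthogonal polynomials with the monomials. -/
noncomputable def windowPairing (k n : ℕ) : Matrix (Fin n) (Fin n) ℤ :=
  Matrix.of fun i j => windowFunctional k (quasiOrthogonalOfDegree k i * Polynomial.X ^ (j : ℕ))

theorem det_windowPairing (k n : ℕ) : (windowPairing k n).det = (windowHankel k n).det := by
  have hdeg (i : Fin n) : (quasiOrthogonalOfDegree k i).Monic ∧
      (quasiOrthogonalOfDegree k i).natDegree = i := by
    simpa only [quasiOrthogonalOfDegree, Nat.div_add_mod] using
      monic_natDegree_quasiOrthogonal k (i / (k + 1)) (i % (k + 1))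
  have h1 := Matrix.det_matrixOfPolynomials (fun i : Fin n => quasiOrthogonalOfDegree k i)
    (fun i => (hdeg i).2) (fun i => (hdeg i).1)
  have h2 : windowPairing k n =
      (Matrix.of fun i j : Fin n => (quasiOrthogonalOfDegree k j).coeff i).transpose *
        windowHankel k n := by
    ext i j
    simp only [windowPairing, windowHankel, Matrix.mul_apply, Matrix.transpose_apply,
      Matrix.of_apply]
    rw [windowFunctional_mul_X_pow k j _ ((hdeg i).2.trans_lt i.2), Finset.sum_range]
  rw [h2, Matrix.det_mul, Matrix.det_transpose, h1, one_mul]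

theorem windowFunctional_mul_X_pow_of_zero (k m j : ℕ) (hj : j ≤ (k + 1) * m) :
    windowFunctional k (quasiOrthogonalOfDegree k ((k + 1) * m) * Polynomial.X ^ j) =
      if j = (k + 1) * m then 1 else 0 := by
  rw [quasiOrthogonalOfDegree, Nat.mul_div_cancel_left _ k.succ_pos, Nat.mul_mod_right,
    windowFunctional_quasiOrthogonal_zero hj]

/-- Negation in `Fin (k + 1)` merges both cases: -t is 0 for t = 0 and k + 1 - t otherwise. -/
theorem windowPairing_apply_finProdFinEquiv {k r : ℕ} (m : Fin r) (t : Fin (k + 1))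
    {j : Fin (r * (k + 1))} (hj : j ≤ finProdFinEquiv (m, -t)) :
    windowPairing k (r * (k + 1)) (finProdFinEquiv (m, t)) j =
      if j = finProdFinEquiv (m, -t) then if t = 0 then 1 else -1 else 0 := by
  have hq : quasiOrthogonalOfDegree k (finProdFinEquiv (m, t) : Fin (r * (k + 1))) =
      quasiOrthogonal k m t := by
    simp only [quasiOrthogonalOfDegree, finProdFinEquiv_apply_val]
    rw [Nat.add_mul_mod_self_left, Nat.mod_eq_of_lt t.2, Nat.add_mul_div_left _ _ k.succ_pos,
      Nat.div_eq_of_lt t.2, zero_add]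
  rw [windowPairing, Matrix.of_apply, hq, if_congr Fin.ext_iff rfl rfl]
  rw [Fin.le_def] at hj
  simp only [finProdFinEquiv_apply_val, Fin.val_neg] at hj ⊢
  split_ifs at hj ⊢ with ht h h
  · subst ht; exact (windowFunctional_quasiOrthogonal_zero (by omega)).trans (if_pos (by omega))
  · subst ht; exact (windowFunctional_quasiOrthogonal_zero (by omega)).trans (if_neg (by omega))
  all_goals
    have ht' : (t : ℕ) ≠ 0 := fun h => ht (Fin.ext h)
    have hlt := t.2
    have hm := mul_add_one (k + 1) (m : ℕ)
    rw [windowFunctional_quasiOrthogonal ht' (by omega)]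
  · exact if_pos (by omega)
  · exact if_neg (by omega)

theorem det_windowHankel_mul (k r : ℕ) :
    (windowHankel k (r * (k + 1))).det = (-1) ^ (r * (k + 1).choose 2) := by
  set e : Equiv.Perm (Fin (r * (k + 1))) :=
    finProdFinEquiv.permCongr (Equiv.prodCongrRight fun _ : Fin r => Equiv.neg (Fin (k + 1)))
    with he
  have hsign : Equiv.Perm.sign e = ((-1) ^ k.choose 2) ^ r := by
    rw [he, Equiv.Perm.sign_permCongr, Equiv.Perm.sign_prodCongrRight]
    simp [Fin.sign_neg_succ, Fin.sign_revPerm]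
  have hval (m : Fin r) (t : Fin (k + 1)) :
      e (finProdFinEquiv (m, t)) = finProdFinEquiv (m, -t) := by
    simp [he, Equiv.permCongr_apply]
  rw [← det_windowPairing, Matrix.det_of_eq_zero_of_lt_perm _ e, hsign,
    ← Equiv.prod_comp finProdFinEquiv, Fintype.prod_prod_type]
  · have (m : Fin r) (t : Fin (k + 1)) : windowPairing k (r * (k + 1)) (finProdFinEquiv (m, t))
        (e (finProdFinEquiv (m, t))) = if t = 0 then 1 else -1 := by
      rw [hval, windowPairing_apply_finProdFinEquiv m t le_rfl, if_pos rfl]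
    simp only [this, Fin.prod_univ_succ]
    -- Per block, the entries contribute k factors -1 and the permutation contributes `k.choose 2`.
    rw [Nat.choose_succ_succ, Nat.choose_one_right, mul_add, pow_add, mul_comm r k,
      mul_comm r (k.choose 2), pow_mul, pow_mul]
    simp [mul_comm]
  · intro i j hij
    obtain ⟨⟨m, t⟩, rfl⟩ := finProdFinEquiv.surjective i
    rw [hval] at hij
    rw [windowPairing_apply_finProdFinEquiv m t hij.le, if_neg hij.ne]

theorem det_windowHankel_mul_add_one (k r : ℕ) :
    (windowHankel k ((k + 1) * r + 1)).det = (windowHankel k ((k + 1) * r)).det := by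
  rw [← det_windowPairing, ← det_windowPairing, Matrix.det_succ_row _ (Fin.last _),
    Finset.sum_eq_single (Fin.last _)]
  · simp only [windowPairing, Matrix.of_apply, Fin.val_last]
    rw [windowFunctional_mul_X_pow_of_zero _ _ _ le_rfl, if_pos rfl]
    rw [Even.neg_one_pow ⟨_, rfl⟩, one_mul, one_mul]
    congr 1
    ext i j
    simp
  · intro j _ hj
    have := Fin.val_lt_last hj
    simp only [windowPairing, Matrix.of_apply, Fin.val_last]
    rw [windowFunctional_mul_X_pow_of_zero _ _ _ this.le, if_neg this.ne]
    simp
  · simp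

theorem det_windowHankel_eq_zero {k n : ℕ} (h0 : ¬ n ≡ 0 [MOD k + 1]) (h1 : ¬ n ≡ 1 [MOD k + 1]) :
    (windowHankel k n).det = 0 := by
  have hdm := Nat.div_add_mod n (k + 1)
  have hlt : n % (k + 1) < k + 1 := Nat.mod_lt n k.succ_pos
  have hs0 : n % (k + 1) ≠ 0 := fun h => h0 (by rw [Nat.ModEq, h, Nat.zero_mod])
  have hk : 1 < k + 1 := by omega
  have hs1 : n % (k + 1) ≠ 1 := fun h => h1 (by rw [Nat.ModEq, h, Nat.mod_eq_of_lt hk])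
  set m := n / (k + 1)
  have hi : (k + 1) * m + 1 < n := by omega
  rw [← det_windowPairing]
  -- The row with t = 1 vanishes before column (k + 1) m + k, which already lies outside the matrix.
  refine Matrix.det_eq_zero_of_row_eq_zero ⟨(k + 1) * m + 1, hi⟩ fun j => ?_
  have hj := j.2
  rw [windowPairing, Matrix.of_apply, quasiOrthogonalOfDegree, Nat.mul_add_mod,
    Nat.mod_eq_of_lt hk,
    Nat.mul_add_div k.succ_pos, Nat.div_eq_of_lt hk, add_zero,
    windowFunctional_quasiOrthogonal one_ne_zero (by rw [mul_add]; omega), mul_add]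
  exact if_neg (by omega)

theorem corollary17 (n k : ℕ) (hn : 1 ≤ n) :
    (∀ n₁ : ℕ, n = (k + 1) * n₁ →
      (Matrix.of fun i j : Fin n =>
        ∑ l ∈ Finset.Icc (-(k : ℤ)) ((k : ℤ) + 1),
          binomInt (2 * (i : ℕ) + 2 * (j : ℕ)) (((i : ℕ) : ℤ) + ((j : ℕ) : ℤ) + l)).det
        = (-1 : ℤ) ^ (n₁ * (k + 1).choose 2)) ∧
    (∀ n₁ : ℕ, n = (k + 1) * n₁ + 1 →
      (Matrix.of fun i j : Fin n =>
        ∑ l ∈ Finset.Icc (-(k : ℤ)) ((k : ℤ) + 1),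
          binomInt (2 * (i : ℕ) + 2 * (j : ℕ)) (((i : ℕ) : ℤ) + ((j : ℕ) : ℤ) + l)).det
        = (-1 : ℤ) ^ (n₁ * (k + 1).choose 2)) ∧
    (¬ n ≡ 0 [MOD k + 1] ∧ ¬ n ≡ 1 [MOD k + 1] →
      (Matrix.of fun i j : Fin n =>
        ∑ l ∈ Finset.Icc (-(k : ℤ)) ((k : ℤ) + 1),
          binomInt (2 * (i : ℕ) + 2 * (j : ℕ)) (((i : ℕ) : ℤ) + ((j : ℕ) : ℤ) + l)).det
        = 0) := by
  rw [← windowHankel_eq]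
  refine ⟨?_, ?_, fun h => det_windowHankel_eq_zero h.1 h.2⟩
  · rintro r rfl
    rw [mul_comm (k + 1) r, det_windowHankel_mul]
  · rintro r rfl
    rw [det_windowHankel_mul_add_one, mul_comm (k + 1) r, det_windowHankel_mul]
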